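/- **Conventions.** For a set $S\subset\mathbb R^D$, $d_S(x)=\inf_{y\in S}\|x-y\|$ (so $d_\emptyset=+\infty$), and $\pi_S(x)=\{y\in S:\|x-y\|=d_S(x)\}$ is the set of projections of $x$ on $S$. For a nonempty bounded set $\sigma$, $m(\sigma)$ is the center of the smallest closed ball containing $\sigma$. For $x\notin S$ with $\pi_S(x)\neq\emptyset$ (which is automatic if $S$ is nonempty and compact), the generalized gradient of $d_S$ at $x$ is $\nabla d_S(x)=\dfrac{x-m(\pi_S(x))}{d_S(x)}$. For $\mu\ge 0$, $Z_\mu(S)$ is the set of all $x\notin S$ with $\pi_S(x)\ne\emptyset$ and $\|\nabla d_S(x)\|\le\mu$; the points of $Z(S):=Z_0(S)$ are the critical points of $S$. $d_H$ is the Hausdorff distance. A $C^2$ submanifold is an embedded submanifold without boundary. For a compact $C^2$ submanifold $M\subset\mathbb R^D$ consider the conditions * (P1) for every $z_0\in Z(M)$, the points of $\pi_M(z_0)$ are the vertices of a non-degenerate simplex, and $z_0$ lies in the relative interior of the convex hull of $\pi_M(z_0)$; * (P2) $Z(M)$ is finite; * (P3) for every $z_0\in Z(M)$ and $x_0\in\pi_M(z_0)$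 there are $\delta,\alpha>0$ such that $\|y-z_0\|^2\ge\|x_0-z_0\|^2+\alpha\|y-x_0\|^2$ for all $y\in M$ with $\|y-x_0\|<\delta$; * (P4) there are $C>0$ and $\mu_0\in(0,1)$ such that for every $\mu\in[0,\mu_0)$ every point of $Z_\mu(M)$ is at distance at most $C\mu$ from $Z(M)$. **Theorem (Stability Theorem for Subsets).** Let $M\subset\mathbb R^D$ be a compact $C^2$ submanifold. There exist positive constants $C_1,C_2,C_3,C_4,C_5$ and $\varepsilon_0$, depending only on $M$, such that the following holds for every nonempty set $A\subset M$ and every $\varepsilon$ with $d_H(A,M)\le\varepsilon\le\varepsilon_0$. 1. For every $z\in Z(A)$ exactly one of the following two possibilities is true: (a) $d_M(z)\le C_1\varepsilon^2$; (b) there is $w\in Z_{C_3\varepsilon}(M)$ with $\|z-w\|\le C_2\varepsilon$. 2. If $M$ satisfies (P4), then for every $z\in Z(A)$ for which (b) holds there is $z'\in Z(M)$ with $\|z-z'\|\le C_4\varepsilon$. 3. If $M$ satisfies (P1), (P2), (P3) and (P4), then for every $z\in Z(A)$ for which (b) holds there is $z'\in Z(M)$ with $\|z-z'\|\le C_4\varepsilon$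 such that every point of $\pi_A(z)$ is at distance at most $C_5\varepsilon$ from $\pi_M(z')$. -/

import Mathlib

namespace DistCrit

/-- `M` is an embedded `m`-dimensional submanifold (without boundary) of class `C²` of `ℝ^D`:
around each of its points there is a `C²` diffeomorphism between open subsets of `ℝ^D` that
carries `M` onto a linear subspace of dimension `m`. -/
def IsC2Submanifold {D : ℕ} (m : ℕ) (M : Set (EuclideanSpace ℝ (Fin D))) : Prop :=
  ∀ x ∈ M, ∃ (Φ : OpenPartialHomeomorph (EuclideanSpace ℝ (Fin D)) (EuclideanSpace ℝ (Fin D)))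
    (V : Submodule ℝ (EuclideanSpace ℝ (Fin D))),
    x ∈ Φ.source ∧ ContDiffOn ℝ 2 Φ Φ.source ∧ ContDiffOn ℝ 2 Φ.symm Φ.target ∧
      Module.finrank ℝ V = m ∧ ∀ y ∈ Φ.source, (y ∈ M ↔ Φ y ∈ V)

/-- The set `π_S(x)` of all projections of `x` on `S`. -/
def proj {D : ℕ} (S : Set (EuclideanSpace ℝ (Fin D))) (x : EuclideanSpace ℝ (Fin D)) :
    Set (EuclideanSpace ℝ (Fin D)) :=
  {y | y ∈ S ∧ dist x y = Metric.infDist x S}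

/-- `c` is the center of a closed ball of minimal radius among those that contain `σ`. -/
def IsMinBallCenter {D : ℕ} (σ : Set (EuclideanSpace ℝ (Fin D)))
    (c : EuclideanSpace ℝ (Fin D)) : Prop :=
  ∃ r : ℝ, σ ⊆ Metric.closedBall c r ∧
    ∀ (c' : EuclideanSpace ℝ (Fin D)) (r' : ℝ), σ ⊆ Metric.closedBall c' r' → r ≤ r'

/-- The smallest enclosing ball of a nonempty bounded set exists and is unique. -/
theorem existsUnique_isMinBallCenter {D : ℕ} (σ : Set (EuclideanSpace ℝ (Fin D)))
    (hne : σ.Nonempty) (hb : Bornology.IsBounded σ) : ∃! c, IsMinBallCenter σ c := by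
  obtain ⟨y₀, hy₀⟩ := hne
  set R : Set ℝ := {r | ∃ c, σ ⊆ Metric.closedBall c r} with hR
  have hRne : R.Nonempty := by
    obtain ⟨r, hr⟩ := hb.subset_closedBall (0 : EuclideanSpace ℝ (Fin D))
    exact ⟨r, 0, hr⟩
  have hR0 : ∀ r ∈ R, 0 ≤ r := by
    rintro r ⟨c, hc⟩
    exact dist_nonneg.trans (Metric.mem_closedBall.1 (hc hy₀))
  have hbdd : BddBelow R := ⟨0, hR0⟩
  set r₀ := sInf R with hr₀
  have hr₀0 : 0 ≤ r₀ := le_csInf hRne hR0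
  have hlow : ∀ c r, σ ⊆ Metric.closedBall c r → r₀ ≤ r := fun c r h => csInf_le hbdd ⟨c, h⟩
  let K : ℕ → Set (EuclideanSpace ℝ (Fin D)) :=
    fun n => ⋂ y ∈ σ, Metric.closedBall y (r₀ + 1 / ((n : ℝ) + 1))
  have hKmem : ∀ n c, c ∈ K n ↔ σ ⊆ Metric.closedBall c (r₀ + 1 / ((n : ℝ) + 1)) := by
    intro n c
    simp only [K, Set.mem_iInter, Set.subset_def, Metric.mem_closedBall]
    exact forall₂_congr fun y _ => by rw [dist_comm]
  have hKclosed : ∀ n, IsClosed (K n) := fun n =>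
    isClosed_biInter fun y _ => Metric.isClosed_closedBall
  have hKne : ∀ n, (K n).Nonempty := by
    intro n
    obtain ⟨r, ⟨c, hc⟩, hr⟩ := exists_lt_of_csInf_lt hRne
      (show sInf R < r₀ + 1 / ((n : ℝ) + 1) by
        have : 0 < 1 / ((n : ℝ) + 1) := by positivity
        linarith)
    exact ⟨c, (hKmem n c).2 (hc.trans (Metric.closedBall_subset_closedBall hr.le))⟩
  have hKanti : ∀ n, K (n + 1) ⊆ K n := by
    intro n c hc
    rw [hKmem] at hc ⊢
    refine hc.trans (Metric.closedBall_subset_closedBall ?_)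
    push_cast
    gcongr
    linarith
  have hK0 : IsCompact (K 0) := by
    refine (isCompact_closedBall y₀ (r₀ + 1 / (((0 : ℕ) : ℝ) + 1))).of_isClosed_subset
      (hKclosed 0) (Set.biInter_subset_of_mem hy₀)
  obtain ⟨c, hc⟩ := IsCompact.nonempty_iInter_of_sequence_nonempty_isCompact_isClosed
    K hKanti hKne hK0 hKclosed
  have hcr : σ ⊆ Metric.closedBall c r₀ := by
    intro y hy
    rw [Metric.mem_closedBall]
    refine le_of_forall_pos_le_add fun e he => ?_
    obtain ⟨n, hn⟩ := exists_nat_one_div_lt he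
    have := Metric.mem_closedBall.1 ((hKmem n c).1 (Set.mem_iInter.1 hc n) hy)
    linarith
  refine ⟨c, ⟨r₀, hcr, hlow⟩, ?_⟩
  rintro c' ⟨r', hc', hmin'⟩
  have h1 : r' = r₀ := le_antisymm (hmin' c r₀ hcr) (hlow c' r' hc')
  subst h1
  by_contra hcc
  have hpos : 0 < ‖c' - c‖ := norm_pos_iff.2 (sub_ne_zero.2 hcc)
  have key : σ ⊆ Metric.closedBall ((1 / 2 : ℝ) • (c' + c))
      (Real.sqrt (r₀ ^ 2 - ‖c' - c‖ ^ 2 / 4)) := by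
    intro y hy
    rw [Metric.mem_closedBall]
    have a1 : ‖y - c‖ ≤ r₀ := by
      simpa [dist_eq_norm] using hcr hy
    have a2 : ‖y - c'‖ ≤ r₀ := by
      simpa [dist_eq_norm] using hc' hy
    have par := parallelogram_law_with_norm ℝ (y - c) (y - c')
    have e1 : y - c + (y - c') = (2 : ℝ) • (y - (1 / 2 : ℝ) • (c' + c)) := by
      module
    have e2 : y - c - (y - c') = c' - c := by abel
    rw [e1, e2, norm_smul, Real.norm_of_nonneg (by norm_num : (0 : ℝ) ≤ 2)] at par
    rw [dist_eq_norm]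
    apply Real.le_sqrt_of_sq_le
    nlinarith [norm_nonneg (y - c), norm_nonneg (y - c')]
  have h2 := hlow _ _ key
  have h3 : Real.sqrt (r₀ ^ 2 - ‖c' - c‖ ^ 2 / 4) ≤ r₀ := by
    rw [Real.sqrt_le_left hr₀0]
    nlinarith
  have h4 : 0 ≤ r₀ ^ 2 - ‖c' - c‖ ^ 2 / 4 := by
    by_contra h
    have hz := Real.sqrt_eq_zero_of_nonpos (not_le.1 h).le
    have a1 : ‖y₀ - c‖ ≤ r₀ := by
      simpa [dist_eq_norm] using hcr hy₀
    have a2 : ‖y₀ - c'‖ ≤ r₀ := by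
      simpa [dist_eq_norm] using hc' hy₀
    have : ‖c' - c‖ ≤ ‖y₀ - c‖ + ‖y₀ - c'‖ := by
      have e : c' - c = (y₀ - c) - (y₀ - c') := by abel
      rw [e]
      exact norm_sub_le _ _
    nlinarith
  have h5 := Real.sq_sqrt h4
  have h6 : Real.sqrt (r₀ ^ 2 - ‖c' - c‖ ^ 2 / 4) = r₀ := le_antisymm h3 h2
  rw [h6] at h5
  nlinarith

/-- The center `m(σ)` of the smallest enclosing ball of a nonempty bounded set `σ`
(an irrelevant value for other sets). -/
noncomputable def minBallCenter {D : ℕ} (σ : Set (EuclideanSpace ℝ (Fin D))) :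
    EuclideanSpace ℝ (Fin D) :=
  Classical.epsilon (IsMinBallCenter σ)

open Classical in
/-- The generalized gradient `∇d_S` of the distance function to `S`, extended by `0` on `S`. -/
noncomputable def genGrad {D : ℕ} (S : Set (EuclideanSpace ℝ (Fin D)))
    (x : EuclideanSpace ℝ (Fin D)) : EuclideanSpace ℝ (Fin D) :=
  if x ∈ S then 0 else (Metric.infDist x S)⁻¹ • (x - minBallCenter (proj S x))

/-- The set `Z(S)` of critical points of `S`. For nonempty compact `S` the set `π_S(z)` is never
empty; for other sets only the points with a projection on `S` can be critical, since the
generalized gradient has no meaning elsewhere. -/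
def critSet {D : ℕ} (S : Set (EuclideanSpace ℝ (Fin D))) : Set (EuclideanSpace ℝ (Fin D)) :=
  {z | z ∉ S ∧ (proj S z).Nonempty ∧ genGrad S z = 0}

/-- The set `Z_μ(S)` of `μ`-critical points of `S`. -/
def muCritSet {D : ℕ} (S : Set (EuclideanSpace ℝ (Fin D))) (μ : ℝ) :
    Set (EuclideanSpace ℝ (Fin D)) :=
  {z | z ∉ S ∧ (proj S z).Nonempty ∧ ‖genGrad S z‖ ≤ μ}

/-- The projections of a critical point are the vertices of a non-degenerate simplex, and the
critical point lies in the relative interior of that simplex. -/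
def P1 {D : ℕ} (M : Set (EuclideanSpace ℝ (Fin D))) : Prop :=
  ∀ z₀ ∈ critSet M,
    AffineIndependent ℝ (fun x : proj M z₀ => (x : EuclideanSpace ℝ (Fin D))) ∧
      z₀ ∈ intrinsicInterior ℝ (convexHull ℝ (proj M z₀))

/-- There are finitely many critical points. -/
def P2 {D : ℕ} (M : Set (EuclideanSpace ℝ (Fin D))) : Prop :=
  (critSet M).Finite

/-- The sphere of radius `d_M(z₀)` around a critical point `z₀` is non-osculating at each of the
projections of `z₀`. -/
def P3 {D : ℕ} (M : Set (EuclideanSpace ℝ (Fin D))) : Prop :=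
  ∀ z₀ ∈ critSet M, ∀ x₀ ∈ proj M z₀, ∃ δ > (0 : ℝ), ∃ α > (0 : ℝ),
    ∀ y ∈ M ∩ Metric.ball x₀ δ, ‖y - z₀‖ ^ 2 ≥ ‖x₀ - z₀‖ ^ 2 + α * ‖y - x₀‖ ^ 2

/-- For small `μ ≥ 0` every `μ`-critical point is at distance at most `C μ` from the set of
critical points (the distance to the empty set being infinite). -/
def P4 {D : ℕ} (M : Set (EuclideanSpace ℝ (Fin D))) : Prop :=
  ∃ C > (0 : ℝ), ∃ μ₀ ∈ Set.Ioo (0 : ℝ) 1, ∀ μ ∈ Set.Ico (0 : ℝ) μ₀, ∀ z ∈ muCritSet M μ,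
    Metric.infEDist z (critSet M) ≤ ENNReal.ofReal (C * μ)

end DistCrit

/-!
# Stability of critical points of the distance function under dense sampling

Everything rests on one property of a compact `C²` submanifold `M`: if `y` is a projection of `z`
on `M` and `b ∈ M`, then `|⟪z - y, b - y⟫| ≤ K * ‖z - y‖ * ‖b - y‖ ^ 2`
(`IsC2Submanifold.exists_hasNormalBound`). Applied to a point `b ∈ A` within `ε` of `y`, it gives
`d_A(z) ^ 2 ≤ d_M(z) ^ 2 + O(ε ^ 2)` (`HasNormalBound.sq_infDist_le`). This gain over the trivial
`d_A ≤ d_M + ε` is what makes all estimates linear in `ε` instead of `√ε`.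

A critical point `z` of `A` is balanced between its projections
(`exists_mem_proj_inner_ge`), so `d_A(w) ^ 2 ≤ d_A(z) ^ 2 + ‖w - z‖ ^ 2` for all `w`.

* If `d_M(z) ≤ 1 / (4 * K)`, all projections of `z` on `A` are `O(ε)`-close to the projection `y` of
  `z` on `M`; being balanced between points that are `O(ε ^ 2)`-close to the hyperplane through `y`
  normal to `z - y`, the point `z` satisfies `d_M(z) = O(ε ^ 2)`
  (`HasNormalBound.infDist_le_mul_sq`).
* Otherwise `d_M(w) ^ 2 ≤ d_M(z) ^ 2 + O(ε ^ 2)` on the ball of radius `ε` about `z`, and a variational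
  argument with the penalized function `d_M(w) - μ * ‖w - z‖`, `μ` a large multiple of `ε`, yields a
  `μ`-critical point of `M` in this ball (`HasNormalBound.exists_muCritSet_near`).

The regimes exclude each other since `M` has no `μ`-critical points with `μ < 1` within distance
`1 / (4 * K)` of itself (`HasNormalBound.lt_infDist_of_mem_muCritSet`). Condition `P4` moves the
`μ`-critical point to a critical point `z'`. Finally, `P3` and compactness make
`‖· - z'‖ ^ 2 - d_M(z') ^ 2` grow quadratically along `M` away from the projections of `z'`, so a
projection of `z` on `A`, where this difference is at most a linear term of size `O(ε)` times the
distance to such a projection plus `O(ε ^ 2)`, is `O(ε)`-close to one of them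
(`HasNormalBound.exists_proj_near`); `P2` makes the constants uniform in `z'`.
-/

namespace DistCrit

open Filter Topology Metric
open scoped RealInnerProductSpace

variable {D : ℕ} {M A : Set (EuclideanSpace ℝ (Fin D))}

/-! ### The quadratic estimate along normal directions -/

/-- `M` deviates quadratically, with constant `K`, from the hyperplanes orthogonal to its normal
vectors. Only the normal vectors `z - y` with `y` a projection of `z` are considered, which avoids
speaking of tangent spaces. -/
def HasNormalBound (M : Set (EuclideanSpace ℝ (Fin D))) (K : ℝ) : Prop :=
  ∀ z, ∀ y ∈ proj M z, ∀ b ∈ M, |⟪z - y, b - y⟫| ≤ K * ‖z - y‖ * ‖b - y‖ ^ 2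

theorem norm_sub_eq_of_mem_proj {S : Set (EuclideanSpace ℝ (Fin D))}
    {x y : EuclideanSpace ℝ (Fin D)} (h : y ∈ proj S x) : ‖x - y‖ = infDist x S := by
  rw [← dist_eq_norm]
  exact h.2

/-- In a chart straightening `M`, a vector `z - y` with `y` a projection of `z` annihilates the
image of the derivative of the parametrization, because `‖z - ·‖` is minimal at `y` along `M`.
What is left of `⟪z - y, b - y⟫` is the second-order remainder of the parametrization. -/
theorem IsC2Submanifold.exists_nhds_normalBound {m : ℕ} (hM : IsC2Submanifold m M)
    {x : EuclideanSpace ℝ (Fin D)} (hx : x ∈ M) :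
    ∃ U ∈ 𝓝 x, ∃ K > (0 : ℝ), ∀ y ∈ U, ∀ b ∈ U, b ∈ M → ∀ z, y ∈ proj M z →
      |⟪z - y, b - y⟫| ≤ K * ‖z - y‖ * ‖b - y‖ ^ 2 := by
  obtain ⟨Φ, V, hxs, h1, h2, -, hV⟩ := hM x hx
  have hψ : ContDiffAt ℝ 2 Φ.symm (Φ x) :=
    h2.contDiffAt (Φ.open_target.mem_nhds (Φ.map_source hxs))
  obtain ⟨K₁, t, ht, hlip⟩ := (hψ.fderiv_right (m := 1) (by norm_num)).exists_lipschitzOnWith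
  obtain ⟨L, s, hs, hLs⟩ := ((h1.contDiffAt (Φ.open_source.mem_nhds hxs)).of_le
    (by norm_num : (1 : WithTop ℕ∞) ≤ 2)).exists_lipschitzOnWith
  obtain ⟨ρ, hρ, hball⟩ := Metric.mem_nhds_iff.1
    (inter_mem ht (Φ.open_target.mem_nhds (Φ.map_source hxs)))
  have hcont : ContinuousAt Φ x := Φ.continuousAt hxs
  refine ⟨s ∩ Φ.source ∩ Φ ⁻¹' ball (Φ x) ρ, inter_mem (inter_mem hs (Φ.open_source.mem_nhds hxs))
    (hcont.preimage_mem_nhds (ball_mem_nhds _ hρ)), K₁ * L ^ 2 + 1, by positivity, ?_⟩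
  rintro y ⟨⟨hys, hysrc⟩, hyρ⟩ b ⟨⟨hbs, hbsrc⟩, hbρ⟩ hbM z hyz
  have hdiff : ∀ u ∈ ball (Φ x) ρ, HasFDerivAt Φ.symm (fderiv ℝ Φ.symm u) u := fun u hu =>
    ((h2.contDiffAt (Φ.open_target.mem_nhds (hball hu).2)).differentiableAt
      (by norm_num)).hasFDerivAt
  have hpV : Φ y ∈ V := (hV y hysrc).1 hyz.1
  have hqV : Φ b ∈ V := (hV b hbsrc).1 hbM
  have hψy : Φ.symm (Φ y) = y := Φ.left_inv hysrc
  have hψb : Φ.symm (Φ b) = b := Φ.left_inv hbsrc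
  -- first-order optimality of the projection `y` along the curve `r ↦ Φ.symm (Φ y + r • v)` in `M`
  have horth : ∀ v ∈ V, ⟪z - y, fderiv ℝ Φ.symm (Φ y) v⟫ = 0 := by
    intro v hv
    have hline : HasDerivAt (fun r : ℝ => Φ y + r • v) v 0 := by
      simpa using ((hasDerivAt_id (0 : ℝ)).smul_const v).const_add (Φ y)
    have hcurve : HasDerivAt (fun r : ℝ => Φ.symm (Φ y + r • v))
        (fderiv ℝ Φ.symm (Φ y) v) 0 := by
      refine HasFDerivAt.comp_hasDerivAt (0 : ℝ) (l := Φ.symm) ?_ hline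
      simpa using hdiff _ hyρ
    have hsq := (hcurve.const_sub z).norm_sq
    have hmin : IsLocalMin (fun r : ℝ => ‖z - Φ.symm (Φ y + r • v)‖ ^ 2) 0 := by
      have hev : ∀ᶠ r : ℝ in 𝓝 0, Φ y + r • v ∈ ball (Φ x) ρ :=
        hline.continuousAt.eventually (isOpen_ball.mem_nhds (by simpa using hyρ))
      filter_upwards [hev] with r hr
      have htgt := (hball hr).2
      have hmem : Φ.symm (Φ y + r • v) ∈ M := by
        rw [hV _ (Φ.map_target htgt), Φ.right_inv htgt]
        exact V.add_mem hpV (V.smul_mem r hv)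
      simp only [zero_smul, add_zero, hψy]
      gcongr
      rw [norm_sub_eq_of_mem_proj hyz, ← dist_eq_norm]
      exact infDist_le_dist_of_mem hmem
    have h0 := hmin.hasDerivAt_eq_zero hsq
    simp only [zero_smul, add_zero, hψy, inner_neg_right] at h0
    linarith
  have hrem : ‖Φ.symm (Φ b) - Φ.symm (Φ y) - fderiv ℝ Φ.symm (Φ y) (Φ b - Φ y)‖ ≤
      K₁ * ‖Φ b - Φ y‖ * ‖Φ b - Φ y‖ := by
    have hseg : segment ℝ (Φ y) (Φ b) ⊆ ball (Φ x) ρ := (convex_ball _ _).segment_subset hyρ hbρ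
    refine Convex.norm_image_sub_le_of_norm_hasFDerivWithin_le'
      (fun u hu => (hdiff u (hseg hu)).hasFDerivWithinAt) (fun u hu => ?_) (convex_segment _ _)
      (left_mem_segment ℝ _ _) (right_mem_segment ℝ _ _)
    refine (hlip.norm_sub_le (hball (hseg hu)).1 (hball hyρ).1).trans ?_
    gcongr
    exact norm_sub_le_of_mem_segment hu
  have hΦ : ‖Φ b - Φ y‖ ≤ L * ‖b - y‖ := hLs.norm_sub_le hbs hys
  rw [hψb, hψy] at hrem
  have hsplit : ⟪z - y, b - y⟫ = ⟪z - y, b - y - fderiv ℝ Φ.symm (Φ y) (Φ b - Φ y)⟫ := by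
    rw [inner_sub_right (z - y) (b - y), horth _ (V.sub_mem hqV hpV), sub_zero]
  rw [hsplit]
  calc _ ≤ ‖z - y‖ * ‖b - y - fderiv ℝ Φ.symm (Φ y) (Φ b - Φ y)‖ := abs_real_inner_le_norm _ _
    _ ≤ ‖z - y‖ * (K₁ * (L * ‖b - y‖) * (L * ‖b - y‖)) := by
        gcongr
        refine hrem.trans ?_
        gcongr
    _ = K₁ * L ^ 2 * ‖z - y‖ * ‖b - y‖ ^ 2 := by ring
    _ ≤ (K₁ * L ^ 2 + 1) * ‖z - y‖ * ‖b - y‖ ^ 2 := by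
        gcongr
        linarith

/-- This plays the role of positive reach. Pairs of points that do not lie in a common chart are
far apart, and for them the estimate is the Cauchy–Schwarz inequality. -/
theorem IsC2Submanifold.exists_hasNormalBound {m : ℕ} (hM : IsC2Submanifold m M)
    (hMc : IsCompact M) : ∃ K > (0 : ℝ), HasNormalBound M K := by
  obtain ⟨K, hK, h⟩ := hMc.induction_on (p := fun s => ∃ K > (0 : ℝ), ∀ y ∈ s, ∀ z,
      y ∈ proj M z → ∀ b ∈ M, |⟪z - y, b - y⟫| ≤ K * ‖z - y‖ * ‖b - y‖ ^ 2)
    ⟨1, one_pos, by simp⟩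
    (fun s t hst ⟨K, hK, h⟩ => ⟨K, hK, fun y hy => h y (hst hy)⟩)
    (fun s t ⟨K, hK, h⟩ ⟨K', hK', h'⟩ => by
      refine ⟨max K K', lt_max_of_lt_left hK, fun y hy z hz b hb => ?_⟩
      rcases hy with hy | hy
      · refine (h y hy z hz b hb).trans ?_
        gcongr
        exact le_max_left _ _
      · refine (h' y hy z hz b hb).trans ?_
        gcongr
        exact le_max_right _ _)
    (fun x hx => by
      obtain ⟨U, hU, K, hK, h⟩ := hM.exists_nhds_normalBound hx
      obtain ⟨δ, hδ, hball⟩ := Metric.mem_nhds_iff.1 hU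
      refine ⟨ball x (δ / 2), mem_nhdsWithin_of_mem_nhds (ball_mem_nhds _ (half_pos hδ)),
        K + 2 / δ, by positivity, fun y hy z hz b hb => ?_⟩
      have hy' : dist y x < δ / 2 := hy
      rcases lt_or_ge (dist b y) (δ / 2) with hby | hby
      · have hbx : dist b x < δ := by linarith [dist_triangle b y x]
        refine (h y (hball (show dist y x < δ by linarith)) b (hball hbx) hb z hz).trans ?_
        gcongr
        linarith [show 0 < 2 / δ by positivity]
      · rw [dist_eq_norm] at hby
        have hone : 1 ≤ 2 / δ * ‖b - y‖ := by
          rw [div_mul_eq_mul_div, le_div_iff₀ hδ]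
          linarith
        calc _ ≤ ‖z - y‖ * ‖b - y‖ * 1 := by
              rw [mul_one]
              exact abs_real_inner_le_norm _ _
          _ ≤ ‖z - y‖ * ‖b - y‖ * (2 / δ * ‖b - y‖) := by gcongr
          _ = 2 / δ * ‖z - y‖ * ‖b - y‖ ^ 2 := by ring
          _ ≤ _ := by
              gcongr
              linarith)
  exact ⟨K, hK, fun z y hy b hb => h y hy.1 z hy b hb⟩

theorem exists_mem_proj (hMc : IsCompact M) (hne : M.Nonempty) (z : EuclideanSpace ℝ (Fin D)) :
    (proj M z).Nonempty := by
  obtain ⟨y, hy, h⟩ := hMc.exists_infDist_eq_dist hne z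
  exact ⟨y, hy, h.symm⟩

theorem infDist_pos_of_notMem_of_proj {S : Set (EuclideanSpace ℝ (Fin D))}
    {z : EuclideanSpace ℝ (Fin D)} (hz : z ∉ S) (hp : (proj S z).Nonempty) :
    0 < infDist z S := by
  obtain ⟨y, hy⟩ := hp
  rw [← hy.2, dist_pos]
  rintro rfl
  exact hz hy.1

/-- The part of `M` outside the ball centred at `z` through a projection `y` spreads
quadratically when `2 * infDist z M * K < 1`. -/
theorem HasNormalBound.le_sq_norm_sub {K : ℝ} (hK : HasNormalBound M K)
    {z y x : EuclideanSpace ℝ (Fin D)} (hy : y ∈ proj M z) (hx : x ∈ M) :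
    infDist z M ^ 2 + (1 - 2 * infDist z M * K) * ‖x - y‖ ^ 2 ≤ ‖z - x‖ ^ 2 := by
  have h := (abs_le.1 (hK z y hy x hx)).2
  have e : z - x = (z - y) - (x - y) := by abel
  rw [e, norm_sub_sq_real (z - y)]
  rw [norm_sub_eq_of_mem_proj hy] at h ⊢
  linarith

/-- Since `M` leaves the normal hyperplane at a projection of `z` only to second order, a sample
of `M` at Hausdorff distance `ε` sees the squared distance up to `O(ε ^ 2)`, not just `O(ε)`. -/
theorem HasNormalBound.sq_infDist_le {K ε : ℝ} (hK : HasNormalBound M K) (hK0 : 0 < K)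
    (hMc : IsCompact M) (hAM : A ⊆ M) (hA : A.Nonempty) (hε : hausdorffDist A M ≤ ε)
    (z : EuclideanSpace ℝ (Fin D)) :
    infDist z A ^ 2 ≤ infDist z M ^ 2 + (1 + 2 * infDist z M * K) * ε ^ 2 := by
  obtain ⟨y, hy⟩ := exists_mem_proj hMc (hA.mono hAM) z
  have hd : 0 ≤ infDist z M := infDist_nonneg
  -- `A` need not be closed, so a point of `A` within `ε` of `y` exists only up to any `t > ε`
  have key : ∀ t > ε, infDist z A ^ 2 ≤ infDist z M ^ 2 + (1 + 2 * infDist z M * K) * t ^ 2 := by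
    intro t ht
    obtain ⟨b, hb, hbt⟩ := exists_dist_lt_of_hausdorffDist_lt' hy.1 (hε.trans_lt ht)
      (hausdorffEDist_ne_top_of_nonempty_of_bounded hA (hA.mono hAM)
        (hMc.isBounded.subset hAM) hMc.isBounded)
    rw [dist_eq_norm] at hbt
    have h1 : infDist z A ≤ ‖z - b‖ := by
      rw [← dist_eq_norm]
      exact infDist_le_dist_of_mem hb
    have h2 := (abs_le.1 (hK z y hy b (hAM hb))).1
    have e : z - b = (z - y) - (b - y) := by abel
    rw [norm_sub_eq_of_mem_proj hy] at h2
    calc infDist z A ^ 2 ≤ ‖z - b‖ ^ 2 := by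
          gcongr
          exact infDist_nonneg
      _ ≤ infDist z M ^ 2 + (1 + 2 * infDist z M * K) * ‖b - y‖ ^ 2 := by
          rw [e, norm_sub_sq_real (z - y), norm_sub_eq_of_mem_proj hy]
          linarith
      _ ≤ _ := by gcongr
  have hlim : Tendsto (fun t : ℝ => infDist z M ^ 2 + (1 + 2 * infDist z M * K) * t ^ 2)
      (𝓝[>] ε) (𝓝 (infDist z M ^ 2 + (1 + 2 * infDist z M * K) * ε ^ 2)) :=
    (Continuous.tendsto (by fun_prop) ε).mono_left nhdsWithin_le_nhds
  exact ge_of_tendsto hlim (eventually_nhdsWithin_of_forall key)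

/-! ### Smallest enclosing balls and critical points -/

theorem proj_subset_closedBall (S : Set (EuclideanSpace ℝ (Fin D)))
    (z : EuclideanSpace ℝ (Fin D)) : proj S z ⊆ closedBall z (infDist z S) := fun y hy => by
  rw [mem_closedBall, dist_comm]
  exact hy.2.le

theorem isMinBallCenter_minBallCenter_proj {S : Set (EuclideanSpace ℝ (Fin D))}
    {z : EuclideanSpace ℝ (Fin D)} (hne : (proj S z).Nonempty) :
    IsMinBallCenter (proj S z) (minBallCenter (proj S z)) :=
  Classical.epsilon_spec (existsUnique_isMinBallCenter _ hne
    (isBounded_closedBall.subset (proj_subset_closedBall S z))).exists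

theorem minBallCenter_eq {σ : Set (EuclideanSpace ℝ (Fin D))} {c : EuclideanSpace ℝ (Fin D)}
    (hne : σ.Nonempty) (hb : Bornology.IsBounded σ) (hc : IsMinBallCenter σ c) :
    minBallCenter σ = c :=
  (existsUnique_isMinBallCenter σ hne hb).unique
    (Classical.epsilon_spec (existsUnique_isMinBallCenter σ hne hb).exists) hc

theorem norm_genGrad {S : Set (EuclideanSpace ℝ (Fin D))} {z : EuclideanSpace ℝ (Fin D)}
    (hz : z ∉ S) :
    ‖genGrad S z‖ = ‖z - minBallCenter (proj S z)‖ / infDist z S := by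
  rw [genGrad, if_neg hz, norm_smul, norm_inv, Real.norm_of_nonneg infDist_nonneg, div_eq_inv_mul]

theorem isMinBallCenter_of_mem_critSet {z : EuclideanSpace ℝ (Fin D)} (hz : z ∈ critSet A) :
    IsMinBallCenter (proj A z) z := by
  obtain ⟨hzA, hp, hg⟩ := hz
  have h0 := infDist_pos_of_notMem_of_proj hzA hp
  have h := norm_genGrad hzA
  rw [hg, norm_zero, eq_comm, div_eq_zero_iff, or_iff_left h0.ne', norm_sub_eq_zero_iff] at h
  have hc := isMinBallCenter_minBallCenter_proj hp
  rwa [← h] at hc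

theorem muCritSet_zero (M : Set (EuclideanSpace ℝ (Fin D))) : muCritSet M 0 = critSet M := by
  ext z
  simp [muCritSet, critSet]

theorem infDist_le_of_proj_subset_closedBall {z c : EuclideanSpace ℝ (Fin D)} {R : ℝ}
    (hz : z ∈ critSet A) (h : proj A z ⊆ closedBall c R) : infDist z A ≤ R := by
  obtain ⟨r, hr, hmin⟩ := isMinBallCenter_of_mem_critSet hz
  obtain ⟨y, hy⟩ := hz.2.1
  have h1 : dist y z ≤ r := hr hy
  rw [dist_comm, hy.2] at h1
  exact h1.trans (hmin c R h)

/-- In terms of convex hulls: a critical point lies in the closed convex hull of its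
projections. -/
theorem exists_mem_proj_inner_ge {z : EuclideanSpace ℝ (Fin D)} (hz : z ∈ critSet A)
    (v : EuclideanSpace ℝ (Fin D)) {η : ℝ} (hη : 0 < η) : ∃ x ∈ proj A z, -η ≤ ⟪x - z, v⟫ := by
  by_contra! hcon
  obtain ⟨y, hy⟩ := hz.2.1
  have hr0 := infDist_pos_of_notMem_of_proj hz.1 hz.2.1
  have hv : 0 < ‖v‖ ^ 2 := by
    have : v ≠ 0 := by
      rintro rfl
      have := hcon y hy
      rw [inner_zero_right] at this
      linarith
    have := norm_pos_iff.2 this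
    positivity
  -- moving the centre to `z - t • v` with `t = η / ‖v‖ ^ 2` would give a smaller ball
  set t := η / ‖v‖ ^ 2 with ht
  have htv : t * ‖v‖ ^ 2 = η := div_mul_cancel₀ _ hv.ne'
  have ht0 : 0 < t := by positivity
  have hsub : proj A z ⊆ closedBall (z - t • v) (√(infDist z A ^ 2 - t * η)) := by
    intro x hx
    rw [mem_closedBall, dist_eq_norm]
    apply Real.le_sqrt_of_sq_le
    have e : x - (z - t • v) = (x - z) + t • v := by abel
    rw [e, norm_add_sq_real, inner_smul_right, norm_smul, Real.norm_of_nonneg ht0.le,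
      norm_sub_rev, norm_sub_eq_of_mem_proj hx]
    nlinarith [mul_lt_mul_of_pos_left (hcon x hx) ht0]
  have h1 := infDist_le_of_proj_subset_closedBall hz hsub
  have h2 : √(infDist z A ^ 2 - t * η) < infDist z A := by
    rw [Real.sqrt_lt' hr0]
    nlinarith
  linarith

/-- The squared distance grows at most quadratically away from a critical point. -/
theorem sq_infDist_le_of_mem_critSet {z : EuclideanSpace ℝ (Fin D)} (hz : z ∈ critSet A)
    (w : EuclideanSpace ℝ (Fin D)) : infDist w A ^ 2 ≤ infDist z A ^ 2 + ‖w - z‖ ^ 2 := by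
  refine le_of_forall_pos_le_add fun η hη => ?_
  obtain ⟨x, hx, h⟩ := exists_mem_proj_inner_ge hz (w - z) (half_pos hη)
  have h1 : infDist w A ≤ ‖x - w‖ := by
    rw [← dist_eq_norm, dist_comm]
    exact infDist_le_dist_of_mem hx.1
  have e : x - w = (x - z) - (w - z) := by abel
  calc infDist w A ^ 2 ≤ ‖x - w‖ ^ 2 := by
        gcongr
        exact infDist_nonneg
    _ ≤ _ := by
        rw [e, norm_sub_sq_real (x - z), norm_sub_rev x z, norm_sub_eq_of_mem_proj hx]
        linarith

/-- If `σ` lies on a sphere around `y`, then, as seen from `y`, every point of `σ` lies on or beyond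
the hyperplane through the center `c` of its smallest enclosing ball orthogonal to `c - y`. -/
theorem IsMinBallCenter.sq_norm_le_inner {σ : Set (EuclideanSpace ℝ (Fin D))}
    {c y : EuclideanSpace ℝ (Fin D)} {d : ℝ} (hc : IsMinBallCenter σ c) (hne : σ.Nonempty)
    (hσ : ∀ x ∈ σ, ‖y - x‖ = d) : ∀ x ∈ σ, ‖y - c‖ ^ 2 ≤ ⟪y - c, y - x⟫ := by
  obtain ⟨r, hr, hmin⟩ := hc
  obtain ⟨x₀, hx₀⟩ := hne
  have hr0 : 0 ≤ r := dist_nonneg.trans (mem_closedBall.1 (hr hx₀))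
  have hcx : ∀ x ∈ σ, ‖c - x‖ ≤ r := fun x hx => by
    rw [← dist_eq_norm, dist_comm]
    exact hr hx
  -- the balls centred on the segment from `c` to `y` are no smaller than the one around `c`
  have hseg : ∀ t ∈ Set.Ioo (0 : ℝ) 1, r ^ 2 + (1 - t) * ‖y - c‖ ^ 2 ≤ d ^ 2 := by
    rintro t ⟨ht0, ht1⟩
    have hid : ∀ x, ‖x - (c + t • (y - c))‖ ^ 2 =
        (1 - t) * ‖c - x‖ ^ 2 + t * ‖y - x‖ ^ 2 - t * (1 - t) * ‖y - c‖ ^ 2 := by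
      intro x
      have e1 : x - (c + t • (y - c)) = -((c - x) + t • (y - c)) := by abel
      have e2 : y - x = (c - x) + (y - c) := by abel
      rw [e1, norm_neg, e2, norm_add_sq_real, norm_add_sq_real, inner_smul_right, norm_smul,
        mul_pow, Real.norm_eq_abs, sq_abs]
      ring
    have hsub : σ ⊆ closedBall (c + t • (y - c))
        (√((1 - t) * r ^ 2 + t * d ^ 2 - t * (1 - t) * ‖y - c‖ ^ 2)) := by
      intro x hx
      rw [mem_closedBall, dist_eq_norm]
      apply Real.le_sqrt_of_sq_le
      rw [hid, hσ x hx]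
      have := pow_le_pow_left₀ (norm_nonneg _) (hcx x hx) 2
      have := mul_le_mul_of_nonneg_left this (sub_nonneg.2 ht1.le)
      linarith
    have h1 := hmin _ _ hsub
    have hnn : 0 ≤ (1 - t) * r ^ 2 + t * d ^ 2 - t * (1 - t) * ‖y - c‖ ^ 2 := by
      have h2 := hid x₀
      rw [hσ x₀ hx₀] at h2
      have := pow_le_pow_left₀ (norm_nonneg _) (hcx x₀ hx₀) 2
      have := mul_le_mul_of_nonneg_left this (sub_nonneg.2 ht1.le)
      linarith [sq_nonneg ‖x₀ - (c + t • (y - c))‖]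
    have h3 := (Real.le_sqrt hr0 hnn).1 h1
    refine le_of_mul_le_mul_left ?_ ht0
    linarith
  have hkey : r ^ 2 + ‖y - c‖ ^ 2 ≤ d ^ 2 := by
    have hlim : Tendsto (fun t : ℝ => r ^ 2 + (1 - t) * ‖y - c‖ ^ 2) (𝓝[>] 0)
        (𝓝 (r ^ 2 + ‖y - c‖ ^ 2)) := by
      have : Continuous fun t : ℝ => r ^ 2 + (1 - t) * ‖y - c‖ ^ 2 := by fun_prop
      have := this.tendsto 0
      rw [sub_zero, one_mul] at this
      exact this.mono_left nhdsWithin_le_nhds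
    refine le_of_tendsto hlim ?_
    filter_upwards [Ioo_mem_nhdsGT (zero_lt_one' ℝ)] with t ht using hseg t ht
  intro x hx
  have h1 := pow_le_pow_left₀ (norm_nonneg _) (hcx x hx) 2
  have e : c - x = (y - x) - (y - c) := by abel
  rw [e, norm_sub_sq_real, hσ x hx, real_inner_comm] at h1
  linarith

/-- A first-order form of the bound `‖∇d_M‖ ≤ μ`: along the direction `∇d_M(y)` the distance to `M`
grows at least at the rate `‖∇d_M(y)‖`, so a growth rate of at most `μ` in all directions bounds
this norm by `μ`. -/
theorem mem_muCritSet_of_eventually_le (hMc : IsCompact M) {y : EuclideanSpace ℝ (Fin D)} {μ : ℝ}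
    (hy : 0 < infDist y M) (hne : M.Nonempty) (hμ : 0 ≤ μ)
    (h : ∀ᶠ w in 𝓝 y, infDist w M ≤ infDist y M + μ * ‖w - y‖) : y ∈ muCritSet M μ := by
  have hyM : y ∉ M := fun hyM => hy.ne' (infDist_zero_of_mem hyM)
  have hp := exists_mem_proj hMc hne y
  refine ⟨hyM, hp, ?_⟩
  rw [norm_genGrad hyM, div_le_iff₀ hy]
  set c := minBallCenter (proj M y)
  set v := y - c with hv
  have hinner : ∀ x ∈ proj M y, ‖v‖ ^ 2 ≤ ⟪v, y - x⟫ :=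
    (isMinBallCenter_minBallCenter_proj hp).sq_norm_le_inner hp
      fun x hx => norm_sub_eq_of_mem_proj hx
  rcases (norm_nonneg v).eq_or_lt with hv0 | hv0
  · rw [← hv0]
    positivity
  -- projections `x n` of points approaching `y` along `v` accumulate at a projection of `y`
  let t : ℕ → ℝ := fun n => 1 / ((n : ℝ) + 1)
  have ht0 : ∀ n, 0 < t n := fun n => by positivity
  have htlim : Tendsto t atTop (𝓝 0) := tendsto_one_div_add_atTop_nhds_zero_nat
  have hwlim : Tendsto (fun n => y + t n • v) atTop (𝓝 y) := by
    simpa using tendsto_const_nhds.add (htlim.smul_const v)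
  choose x hx using fun n => exists_mem_proj hMc hne (y + t n • v)
  obtain ⟨a, haM, φ, hφ, hxa⟩ := hMc.tendsto_subseq fun n => (hx n).1
  have hwφ := hwlim.comp hφ.tendsto_atTop
  have htφ := htlim.comp hφ.tendsto_atTop
  have ha : a ∈ proj M y := by
    refine ⟨haM, tendsto_nhds_unique (hwφ.dist hxa) ?_⟩
    have := ((continuous_infDist_pt M).tendsto y).comp hwφ
    exact this.congr fun n => (hx (φ n)).2.symm
  have hineq : ∀ᶠ n in atTop, 2 * ⟪v, y - x (φ n)⟫ + t (φ n) * ‖v‖ ^ 2 ≤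
      2 * infDist y M * μ * ‖v‖ + t (φ n) * (μ * ‖v‖) ^ 2 := by
    filter_upwards [hwφ.eventually h] with n hn
    have hd := norm_sub_eq_of_mem_proj (hx (φ n))
    simp only [Function.comp_apply, add_sub_cancel_left, norm_smul,
      Real.norm_of_nonneg (ht0 _).le] at hn
    rw [← hd] at hn
    have hdy : infDist y M ≤ ‖y - x (φ n)‖ := by
      rw [← dist_eq_norm]
      exact infDist_le_dist_of_mem (hx _).1
    have h1 := pow_le_pow_left₀ (norm_nonneg _) hn 2
    have h2 := pow_le_pow_left₀ hy.le hdy 2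
    have e : y + t (φ n) • v - x (φ n) = (y - x (φ n)) + t (φ n) • v := by abel
    rw [e, norm_add_sq_real, inner_smul_right, norm_smul, Real.norm_of_nonneg (ht0 _).le,
      real_inner_comm] at h1
    refine le_of_mul_le_mul_left ?_ (ht0 (φ n))
    linarith
  have hlim1 : Tendsto (fun n => 2 * ⟪v, y - x (φ n)⟫ + t (φ n) * ‖v‖ ^ 2) atTop
      (𝓝 (2 * ⟪v, y - a⟫ + 0 * ‖v‖ ^ 2)) :=
    (((tendsto_const_nhds.inner (tendsto_const_nhds.sub hxa))).const_mul 2).add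
      (htφ.mul_const _)
  have hlim2 : Tendsto (fun n => 2 * infDist y M * μ * ‖v‖ + t (φ n) * (μ * ‖v‖) ^ 2) atTop
      (𝓝 (2 * infDist y M * μ * ‖v‖ + 0 * (μ * ‖v‖) ^ 2)) :=
    tendsto_const_nhds.add (htφ.mul_const _)
  have h1 := le_of_tendsto_of_tendsto hlim1 hlim2 hineq
  have h2 := hinner a ha
  refine le_of_mul_le_mul_left ?_ hv0
  linarith

/-! ### The two regimes for critical points of a dense subset -/

/-- Within distance `1 / (4 * K)` of `M` projections are unique, so the gradient has norm `1`. -/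
theorem HasNormalBound.lt_infDist_of_mem_muCritSet {K μ : ℝ} (hK : HasNormalBound M K)
    (hK0 : 0 < K) (hμ : μ < 1) {w : EuclideanSpace ℝ (Fin D)} (hw : w ∈ muCritSet M μ) :
    1 / (4 * K) < infDist w M := by
  obtain ⟨hwM, ⟨y, hy⟩, hg⟩ := hw
  by_contra! hle
  rw [le_div_iff₀ (by positivity)] at hle
  have hsing : proj M w = {y} := by
    refine Set.eq_singleton_iff_unique_mem.2 ⟨hy, fun x hx => ?_⟩
    have h := hK.le_sq_norm_sub hy hx.1
    rw [norm_sub_eq_of_mem_proj hx] at h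
    have h1 : ‖x - y‖ ^ 2 ≤ 0 := by nlinarith [sq_nonneg ‖x - y‖]
    exact sub_eq_zero.1 (norm_eq_zero.1 (pow_eq_zero_iff two_ne_zero |>.1
      (le_antisymm h1 (sq_nonneg _))))
  have hc : minBallCenter (proj M w) = y := by
    rw [hsing]
    refine minBallCenter_eq (Set.singleton_nonempty y) Bornology.isBounded_singleton
      ⟨0, by simp, fun c r h => ?_⟩
    exact dist_nonneg.trans (mem_closedBall.1 (h rfl))
  rw [norm_genGrad hwM, hc, norm_sub_eq_of_mem_proj hy,
    div_self (infDist_pos_of_notMem_of_proj hwM ⟨y, hy⟩).ne'] at hg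
  linarith

/-- All projections of `z` on `A` lie within `O(ε)` of the projection `y` of `z` on `M`, hence
within `O(ε ^ 2)` of the hyperplane through `y` normal to `z - y`. As `z` is balanced between
them, `z` itself is that close to the hyperplane. -/
theorem HasNormalBound.infDist_le_mul_sq {K ε : ℝ} (hK : HasNormalBound M K) (hK0 : 0 < K)
    (hMc : IsCompact M) (hAM : A ⊆ M) (hε : hausdorffDist A M ≤ ε)
    {z : EuclideanSpace ℝ (Fin D)} (hz : z ∈ critSet A) (hd : infDist z M ≤ 1 / (4 * K)) :
    infDist z M ≤ 3 * K * ε ^ 2 := by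
  have hA : A.Nonempty := hz.2.1.mono fun _ h => h.1
  obtain ⟨y, hy⟩ := exists_mem_proj hMc (hA.mono hAM) z
  rw [le_div_iff₀ (by positivity)] at hd
  rcases (infDist_nonneg (x := z) (s := M)).eq_or_lt with h0 | h0
  · rw [← h0]
    positivity
  have hr := hK.sq_infDist_le hK0 hMc hAM hA hε z
  have hnear : ∀ x ∈ proj A z, ‖x - y‖ ^ 2 ≤ 3 * ε ^ 2 := by
    intro x hx
    have h := hK.le_sq_norm_sub hy (hAM hx.1)
    rw [norm_sub_eq_of_mem_proj hx] at h
    nlinarith [sq_nonneg ‖x - y‖, sq_nonneg ε]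
  refine le_of_mul_le_mul_left ?_ h0
  refine le_of_forall_pos_le_add fun η hη => ?_
  obtain ⟨x, hx, h⟩ := exists_mem_proj_inner_ge hz (z - y) hη
  have h1 := (abs_le.1 (hK z y hy x (hAM hx.1))).2
  have e : x - z = (x - y) - (z - y) := by abel
  rw [e, inner_sub_left, real_inner_self_eq_norm_sq, real_inner_comm] at h
  rw [norm_sub_eq_of_mem_proj hy] at h h1
  have h2 := mul_le_mul_of_nonneg_left (hnear x hx) (mul_pos hK0 h0).le
  linarith

theorem mem_critSet_of_infDist_eq (hAM : A ⊆ M)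
    {z : EuclideanSpace ℝ (Fin D)} (hz : z ∈ critSet A) (h : infDist z A = infDist z M) :
    z ∈ critSet M := by
  obtain ⟨r, hr, hmin⟩ := isMinBallCenter_of_mem_critSet hz
  have hpos := infDist_pos_of_notMem_of_proj hz.1 hz.2.1
  have hzM : z ∉ M := fun hzM => (h ▸ hpos).ne' (infDist_zero_of_mem hzM)
  have hsub : proj A z ⊆ proj M z := fun x hx => ⟨hAM hx.1, hx.2.trans h⟩
  have hp : (proj M z).Nonempty := hz.2.1.mono hsub
  obtain ⟨x, hx⟩ := hz.2.1
  have hrA : infDist z M ≤ r := by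
    rw [← h, ← hx.2, dist_comm]
    exact hr hx
  have hc : minBallCenter (proj M z) = z :=
    minBallCenter_eq hp (isBounded_closedBall.subset (proj_subset_closedBall M z))
      ⟨r, (proj_subset_closedBall M z).trans (closedBall_subset_closedBall hrA),
        fun c' r' hc' => hmin c' r' (hsub.trans hc')⟩
  refine ⟨hzM, hp, norm_eq_zero.1 ?_⟩
  rw [norm_genGrad hzM, hc, sub_self, norm_zero, zero_div]

/-- Along `‖w - z‖ ≤ ε` the squared distance to `M` exceeds its value at `z` by `O(ε ^ 2)` only, so
a maximizer `w` of `infDist w M - μ * ‖w - z‖` over this ball is interior as soon as `μ` is a large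
multiple of `ε`, and such a `w` is `μ`-critical. -/
theorem HasNormalBound.exists_muCritSet_near {K ε R d₀ : ℝ} (hK : HasNormalBound M K)
    (hK0 : 0 < K) (hMc : IsCompact M) (hAM : A ⊆ M) (hε : hausdorffDist A M ≤ ε)
    {z : EuclideanSpace ℝ (Fin D)} (hz : z ∈ critSet A) (hR : infDist z M ≤ R) (hd₀ : 0 < d₀)
    (hd : d₀ ≤ infDist z M) :
    ∃ w ∈ muCritSet M ((2 + 2 * R * K) / d₀ * ε), dist z w ≤ ε := by
  have hA : A.Nonempty := hz.2.1.mono fun _ h => h.1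
  have hMne := hA.mono hAM
  have hε0 : 0 ≤ ε := hausdorffDist_nonneg.trans hε
  have hR0 : 0 < R := hd₀.trans_le (hd.trans hR)
  have hr := hK.sq_infDist_le hK0 hMc hAM hA hε z
  rcases hε0.eq_or_lt with rfl | hεpos
  -- `A` is dense in `M`: then `z` is itself critical for `M`
  · refine ⟨z, ?_, (dist_self z).le⟩
    rw [mul_zero, muCritSet_zero]
    refine mem_critSet_of_infDist_eq hAM hz
      (le_antisymm ?_ (infDist_le_infDist_of_subset hAM hA))
    refine le_of_sq_le_sq ?_ infDist_nonneg
    linarith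
  set μ := (2 + 2 * R * K) / d₀ * ε with hμ
  have hμ0 : 0 ≤ μ := by positivity
  have hd₀μ : d₀ * μ = (2 + 2 * R * K) * ε := by
    rw [hμ]
    field_simp
  obtain ⟨w, hw, hmax⟩ := (isCompact_closedBall z ε).exists_isMaxOn
    (nonempty_closedBall.2 hε0)
    (f := fun w => infDist w M - μ * ‖w - z‖) (by
      have := continuous_infDist_pt M
      fun_prop)
  have hwz : infDist z M + μ * ‖w - z‖ ≤ infDist w M := by
    have := hmax (mem_closedBall_self hε0)
    simp only [Set.mem_ofPred_eq, sub_self, norm_zero, mul_zero, sub_zero] at this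
    linarith
  have hwε : ‖w - z‖ ≤ ε := by
    rw [← dist_eq_norm]
    exact hw
  have hint : ‖w - z‖ < ε := by
    refine lt_of_le_of_ne hwε fun heq => ?_
    have h1 : infDist w M ≤ infDist w A := infDist_le_infDist_of_subset hAM hA
    have h2 := pow_le_pow_left₀ infDist_nonneg h1 2
    have h3 := sq_infDist_le_of_mem_critSet hz w
    rw [heq] at hwz h3
    have h4 := pow_le_pow_left₀ (add_nonneg infDist_nonneg (mul_nonneg hμ0 hε0)) hwz 2
    have h5 : (2 + 2 * R * K) * ε ^ 2 ≤ infDist z M * μ * ε := by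
      calc (2 + 2 * R * K) * ε ^ 2 = d₀ * μ * ε := by rw [hd₀μ]; ring
        _ ≤ _ := by gcongr
    have h6 : (1 + 2 * infDist z M * K) * ε ^ 2 ≤ (1 + 2 * R * K) * ε ^ 2 := by gcongr
    have h7 : 0 < (2 + 2 * R * K) * ε ^ 2 := by positivity
    linarith [sq_nonneg (μ * ε)]
  refine ⟨w, mem_muCritSet_of_eventually_le hMc ?_ hMne hμ0 ?_, by
    rw [dist_comm, dist_eq_norm]
    exact hwε⟩
  · have : 0 ≤ μ * ‖w - z‖ := by positivity
    linarith
  · have hnhds : ball z ε ∈ 𝓝 w := isOpen_ball.mem_nhds (by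
      rw [mem_ball, dist_eq_norm]
      exact hint)
    filter_upwards [hnhds] with u hu
    have h1 : infDist u M - μ * ‖u - z‖ ≤ infDist w M - μ * ‖w - z‖ :=
      hmax (ball_subset_closedBall hu)
    have h2 := mul_le_mul_of_nonneg_left (norm_sub_le_norm_sub_add_norm_sub u w z) hμ0
    linarith

/-! ### Consequences of the non-degeneracy conditions -/

theorem P4.exists_critSet_near (h : P4 M) {c : ℝ} (hc : 0 < c) :
    ∃ C > (0 : ℝ), ∃ ε₀ > (0 : ℝ), ∀ ε, 0 ≤ ε → ε ≤ ε₀ → ∀ z, ∀ w ∈ muCritSet M (c * ε),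
      dist z w ≤ ε → ∃ z' ∈ critSet M, dist z z' ≤ C * ε := by
  obtain ⟨C, hC, μ₀, hμ₀, h⟩ := h
  have hμ₀0 := hμ₀.1
  refine ⟨C * c + 2, by positivity, μ₀ / (2 * c), by positivity, fun ε hε0 hε z w hw hzw => ?_⟩
  rcases hε0.eq_or_lt with rfl | hpos
  · rw [mul_zero, muCritSet_zero] at hw
    exact ⟨w, hw, by simpa using hzw⟩
  · rw [le_div_iff₀ (by positivity)] at hε
    -- the extra `ε` is there because the distance to `critSet M` need not be attained
    have h1 := h (c * ε) ⟨by positivity, by linarith⟩ w hw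
    have h2 : infEDist w (critSet M) < ENNReal.ofReal (C * (c * ε) + ε) :=
      h1.trans_lt ((ENNReal.ofReal_lt_ofReal_iff (by positivity)).2 (by linarith))
    obtain ⟨z', hz', hd⟩ := infEDist_lt_iff.1 h2
    rw [edist_dist, ENNReal.ofReal_lt_ofReal_iff (by positivity)] at hd
    exact ⟨z', hz', by linarith [dist_triangle z w z']⟩

/-- Compactness turns the local growth condition of `P3` into a global one. -/
theorem P3.exists_quadratic_growth (h : P3 M) (hMc : IsCompact M)
    {z₀ : EuclideanSpace ℝ (Fin D)} (hz₀ : z₀ ∈ critSet M) :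
    ∃ α > (0 : ℝ), ∀ y ∈ M, ∃ x ∈ proj M z₀,
      infDist z₀ M ^ 2 + α * ‖y - x‖ ^ 2 ≤ ‖y - z₀‖ ^ 2 := by
  obtain ⟨α, hα, H⟩ := hMc.induction_on (p := fun s => ∃ α > (0 : ℝ), ∀ y ∈ s, y ∈ M →
      ∃ x ∈ proj M z₀, infDist z₀ M ^ 2 + α * ‖y - x‖ ^ 2 ≤ ‖y - z₀‖ ^ 2)
    ⟨1, one_pos, by simp⟩
    (fun s t hst ⟨α, hα, H⟩ => ⟨α, hα, fun y hy => H y (hst hy)⟩)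
    (fun s t ⟨α, hα, H⟩ ⟨β, hβ, H'⟩ => by
      refine ⟨min α β, lt_min hα hβ, fun y hy hyM => ?_⟩
      rcases hy with hy | hy
      · obtain ⟨x, hx, hle⟩ := H y hy hyM
        refine ⟨x, hx, le_trans ?_ hle⟩
        gcongr
        exact min_le_left _ _
      · obtain ⟨x, hx, hle⟩ := H' y hy hyM
        refine ⟨x, hx, le_trans ?_ hle⟩
        gcongr
        exact min_le_right _ _)
    (fun y₀ hy₀ => by
      by_cases hp : y₀ ∈ proj M z₀
      · obtain ⟨δ, hδ, α, hα, H⟩ := h z₀ hz₀ y₀ hp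
        refine ⟨ball y₀ δ, mem_nhdsWithin_of_mem_nhds (ball_mem_nhds _ hδ), α, hα,
          fun y hy hyM => ⟨y₀, hp, ?_⟩⟩
        rw [← norm_sub_eq_of_mem_proj hp, norm_sub_rev z₀]
        exact H y ⟨hyM, hy⟩
      · obtain ⟨x, hx⟩ := hz₀.2.1
        have hlt : infDist z₀ M < ‖y₀ - z₀‖ := by
          rw [norm_sub_rev, ← dist_eq_norm]
          exact lt_of_le_of_ne (infDist_le_dist_of_mem hy₀) fun he => hp ⟨hy₀, he.symm⟩
        have hgap : 0 < ‖y₀ - z₀‖ ^ 2 - infDist z₀ M ^ 2 :=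
          sub_pos.2 (pow_lt_pow_left₀ hlt infDist_nonneg two_ne_zero)
        set α := (‖y₀ - z₀‖ ^ 2 - infDist z₀ M ^ 2) / (1 + ‖y₀ - x‖ ^ 2) with hα
        have hα0 : 0 < α := by positivity
        have hy₀lt : infDist z₀ M ^ 2 + α * ‖y₀ - x‖ ^ 2 < ‖y₀ - z₀‖ ^ 2 := by
          have : α * (1 + ‖y₀ - x‖ ^ 2) = ‖y₀ - z₀‖ ^ 2 - infDist z₀ M ^ 2 :=
            div_mul_cancel₀ _ (by positivity)
          linarith
        have hev : ∀ᶠ y in 𝓝 y₀, infDist z₀ M ^ 2 + α * ‖y - x‖ ^ 2 < ‖y - z₀‖ ^ 2 :=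
          ContinuousAt.eventually_lt (by fun_prop) (by fun_prop) hy₀lt
        exact ⟨_, mem_nhdsWithin_of_mem_nhds hev, α, hα0, fun y hy _ => ⟨x, hx, le_of_lt hy⟩⟩)
  exact ⟨α, hα, fun y hy => H y hy hy⟩

/-- With `h = z - z₀` and `x'` a projection of `z₀` on `M`, comparing the distances of `z` to `x` and
to `x'` leaves the cross term `⟪x - x', h⟫` and an error `O(ε ^ 2)`, which quadratic growth of the
distance to `z₀` turns into `‖x - x'‖ = O(ε)`. -/
theorem HasNormalBound.exists_proj_near {K R c : ℝ} (hK : HasNormalBound M K)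
    (hK0 : 0 < K) (hMc : IsCompact M) (hR : 0 < R) (hc : 0 < c) (h3 : P3 M)
    {z₀ : EuclideanSpace ℝ (Fin D)} (hz₀ : z₀ ∈ critSet M) :
    ∃ C > (0 : ℝ), ∀ (A : Set (EuclideanSpace ℝ (Fin D))) (ε : ℝ), A ⊆ M →
      hausdorffDist A M ≤ ε → ∀ z, infDist z M ≤ R → dist z z₀ ≤ c * ε →
        ∀ x ∈ proj A z, ∃ x' ∈ proj M z₀, dist x x' ≤ C * ε := by
  obtain ⟨α, hα, H⟩ := h3.exists_quadratic_growth hMc hz₀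
  have hRK : 0 < 1 + 2 * R * K := by positivity
  refine ⟨(2 * c + (1 + 2 * R * K)) / α + 1, by positivity,
    fun A ε hAM hε z hzR hzz₀ x hx => ?_⟩
  have hε0 : 0 ≤ ε := hausdorffDist_nonneg.trans hε
  obtain ⟨x', hx', hgrow⟩ := H x (hAM hx.1)
  refine ⟨x', hx', ?_⟩
  rw [dist_eq_norm] at hzz₀ ⊢
  have hr := hK.sq_infDist_le hK0 hMc hAM ⟨x, hx.1⟩ hε z
  have hzx' : infDist z M ^ 2 ≤ ‖z - x'‖ ^ 2 := by
    gcongr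
    · exact infDist_nonneg
    · rw [← dist_eq_norm]
      exact infDist_le_dist_of_mem hx'.1
  have hexp : ∀ u, ‖z - u‖ ^ 2 = ‖z - z₀‖ ^ 2 + 2 * ⟪z - z₀, z₀ - u⟫ + ‖z₀ - u‖ ^ 2 := by
    intro u
    rw [← norm_add_sq_real, sub_add_sub_cancel]
  have hx1 := hexp x
  have hx2 := hexp x'
  rw [norm_sub_eq_of_mem_proj hx, norm_sub_rev z₀ x] at hx1
  rw [norm_sub_eq_of_mem_proj hx'] at hx2
  have hcross : ⟪z - z₀, z₀ - x'⟫ - ⟪z - z₀, z₀ - x⟫ ≤ c * ε * ‖x - x'‖ := by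
    rw [← inner_sub_right, sub_sub_sub_cancel_left]
    refine (real_inner_le_norm _ _).trans ?_
    gcongr
  have hRε : (1 + 2 * infDist z M * K) * ε ^ 2 ≤ (1 + 2 * R * K) * ε ^ 2 := by gcongr
  have hmain : α * ‖x - x'‖ ^ 2 ≤ 2 * (c * ε * ‖x - x'‖) + (1 + 2 * R * K) * ε ^ 2 := by
    linarith
  by_contra! hlt
  have hquot : 0 ≤ (2 * c + (1 + 2 * R * K)) / α * ε := by positivity
  have hu : ε < ‖x - x'‖ := by linarith
  have hu2 : (1 + 2 * R * K) * ε ^ 2 ≤ (1 + 2 * R * K) * (ε * ‖x - x'‖) := by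
    rw [sq]
    gcongr
  have hu3 : α * ‖x - x'‖ ≤ (2 * c + (1 + 2 * R * K)) * ε := by
    refine le_of_mul_le_mul_right ?_ (hε0.trans_lt hu)
    linarith
  have hu4 : ‖x - x'‖ ≤ (2 * c + (1 + 2 * R * K)) / α * ε := by
    rw [div_mul_eq_mul_div, le_div_iff₀ hα]
    linarith
  linarith

end DistCrit

open DistCrit Metric in
theorem theorem1p3 (D m : ℕ) (M : Set (EuclideanSpace ℝ (Fin D)))
    (hMc : IsCompact M) (hM : DistCrit.IsC2Submanifold m M) :
    ∃ C₁ > (0 : ℝ), ∃ C₂ > (0 : ℝ), ∃ C₃ > (0 : ℝ), ∃ C₄ > (0 : ℝ), ∃ C₅ > (0 : ℝ),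
      ∃ ε₀ > (0 : ℝ),
      ∀ (A : Set (EuclideanSpace ℝ (Fin D))) (ε : ℝ), A ⊆ M → A.Nonempty →
        Metric.hausdorffDist A M ≤ ε → ε ≤ ε₀ →
        (∀ z ∈ DistCrit.critSet A,
          Xor (Metric.infDist z M ≤ C₁ * ε ^ 2)
            (∃ w ∈ DistCrit.muCritSet M (C₃ * ε), dist z w ≤ C₂ * ε)) ∧
        (DistCrit.P4 M → ∀ z ∈ DistCrit.critSet A,
          (∃ w ∈ DistCrit.muCritSet M (C₃ * ε), dist z w ≤ C₂ * ε) →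
            ∃ z' ∈ DistCrit.critSet M, dist z z' ≤ C₄ * ε) ∧
        (DistCrit.P1 M → DistCrit.P2 M → DistCrit.P3 M → DistCrit.P4 M →
          ∀ z ∈ DistCrit.critSet A,
          (∃ w ∈ DistCrit.muCritSet M (C₃ * ε), dist z w ≤ C₂ * ε) →
            ∃ z' ∈ DistCrit.critSet M, dist z z' ≤ C₄ * ε ∧
              ∀ x ∈ DistCrit.proj A z, ∃ x' ∈ DistCrit.proj M z', dist x x' ≤ C₅ * ε) := by
  obtain ⟨K, hK0, hK⟩ := hM.exists_hasNormalBound hMc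
  obtain ⟨R, hR0, hMR⟩ := hMc.isBounded.subset_closedBall_lt 0 0
  -- critical points of `A` lie in a fixed bounded region
  have hbound : ∀ A ⊆ M, ∀ z ∈ critSet A, infDist z M ≤ R := fun A hAM z hz =>
    (infDist_le_infDist_of_subset hAM (hz.2.1.mono fun _ h => h.1)).trans
      (infDist_le_of_proj_subset_closedBall hz fun _ hx => hMR (hAM hx.1))
  set c := (2 + 2 * R * K) / (1 / (4 * K)) with hc
  have hc0 : 0 < c := by positivity
  obtain ⟨C₄, hC₄, ε₄, hε₄, H4⟩ : ∃ C₄ > (0 : ℝ), ∃ ε₄ > (0 : ℝ), P4 M → ∀ ε, 0 ≤ ε → ε ≤ ε₄ →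
      ∀ z, ∀ w ∈ muCritSet M (c * ε), dist z w ≤ ε → ∃ z' ∈ critSet M, dist z z' ≤ C₄ * ε := by
    by_cases h : P4 M
    · obtain ⟨C, hC, e, he, H⟩ := h.exists_critSet_near hc0
      exact ⟨C, hC, e, he, fun _ => H⟩
    · exact ⟨1, one_pos, 1, one_pos, fun h' => absurd h' h⟩
  obtain ⟨C₅, hC₅, H5⟩ : ∃ C₅ > (0 : ℝ), P2 M → P3 M → ∀ z' ∈ critSet M,
      ∀ (A : Set (EuclideanSpace ℝ (Fin D))) (ε : ℝ), A ⊆ M → hausdorffDist A M ≤ ε →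
        ∀ z, infDist z M ≤ R → dist z z' ≤ C₄ * ε →
          ∀ x ∈ proj A z, ∃ x' ∈ proj M z', dist x x' ≤ C₅ * ε := by
    by_cases h : P2 M ∧ P3 M
    · have hex := fun z' (hz' : z' ∈ critSet M) =>
        hK.exists_proj_near hK0 hMc hR0 hC₄ h.2 hz'
      choose! f hf0 hf using hex
      obtain ⟨b, hb⟩ := (h.1.image f).bddAbove
      refine ⟨max b 1, by positivity, fun _ _ z' hz' A ε hAM hε z hz hzz' x hx => ?_⟩
      obtain ⟨x', hx', hd⟩ := hf z' hz' A ε hAM hε z hz hzz' x hx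
      refine ⟨x', hx', hd.trans ?_⟩
      have hε0 : 0 ≤ ε := hausdorffDist_nonneg.trans hε
      gcongr
      exact (hb ⟨z', hz', rfl⟩).trans (le_max_left _ _)
    · exact ⟨1, one_pos, fun h2 h3 => absurd ⟨h2, h3⟩ h⟩
  have hd₀ : 0 < 1 / (4 * K) := by positivity
  refine ⟨3 * K, by positivity, 1, one_pos, c, hc0, C₄, hC₄, C₅, hC₅,
    min (min 1 ε₄) (min (1 / (2 * c)) (1 / (4 * K) / (1 + 3 * K))), by positivity, ?_⟩
  intro A ε hAM hA hε hεle
  have hε0 : 0 ≤ ε := hausdorffDist_nonneg.trans hε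
  obtain ⟨⟨hε1, hεε₄⟩, hεc, hεK⟩ := by simpa only [le_min_iff] using hεle
  rw [le_div_iff₀ (by positivity)] at hεc hεK
  simp only [one_mul]
  have part2 : P4 M → ∀ z ∈ critSet A, (∃ w ∈ muCritSet M (c * ε), dist z w ≤ ε) →
      ∃ z' ∈ critSet M, dist z z' ≤ C₄ * ε := fun h4 z _ ⟨w, hw, hzw⟩ =>
    H4 h4 ε hε0 hεε₄ z w hw hzw
  refine ⟨fun z hz => ?_, part2, fun _ h2 h3 h4 z hz hb => ?_⟩
  · have hor : infDist z M ≤ 3 * K * ε ^ 2 ∨ ∃ w ∈ muCritSet M (c * ε), dist z w ≤ ε := by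
      rcases le_total (infDist z M) (1 / (4 * K)) with hd | hd
      · exact Or.inl (hK.infDist_le_mul_sq hK0 hMc hAM hε hz hd)
      · exact Or.inr (hK.exists_muCritSet_near hK0 hMc hAM hε hz (hbound A hAM z hz) hd₀ hd)
    -- `w` stays at distance more than `1 / (4 * K)` from `M`, which separates the two regimes
    have hnot : ¬(infDist z M ≤ 3 * K * ε ^ 2 ∧
        ∃ w ∈ muCritSet M (c * ε), dist z w ≤ ε) := by
      rintro ⟨ha, w, hw, hzw⟩
      have h1 := hK.lt_infDist_of_mem_muCritSet hK0 (by linarith) hw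
      have h2 := infDist_le_infDist_add_dist (s := M) (x := w) (y := z)
      rw [dist_comm] at h2
      have h3 : 3 * K * ε ^ 2 ≤ 3 * K * ε := by
        gcongr
        nlinarith
      linarith
    exact (xor_iff_or_and_not_and _ _).2 ⟨hor, hnot⟩
  · obtain ⟨z', hz', hd⟩ := part2 h4 z hz hb
    exact ⟨z', hz', hd, H5 h2 h3 z' hz' A ε hAM hε z (hbound A hAM z hz) hd⟩
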